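/- Let $K,s,M,N$ be positive integers with $M=Ks$ and $M\ge N\ge s$, let $0<\delta<1$ and $\epsilon=(1+\delta)^3-1$. Let $x_1,\dots,x_M$ be independent random vectors in $\mathbb R^N$, each uniformly distributed on the unit sphere of $\mathbb R^N$. Let $J_1,\dots,J_K$ be a (deterministic) partition of $\{1,\dots,M\}$ into $K$ sets of size $s$, and for each $k$ let $P_k$ be the orthogonal projection of $\mathbb R^N$ onto the linear span of $\{x_i: i\in J_k\}$. Then for all fixed $k\ne l$, $$ \mathbb P\left(\frac1{1+\epsilon}-\epsilon\sqrt{\frac{(1+\epsilon)N}{s}}\ \le\ \frac{N}{s^2}\operatorname{tr}[P_lP_k]\ \le\ 1+\epsilon\left(1+\sqrt{\frac{(1+\epsilon)N}{s}}\right)+\frac{N\epsilon^2}{4s}\right)\ \ge\ 1-R_1-R_2, $$ where $$ R_1=2s\,e^{(1+\delta)s/2-s(s-1)(\delta^2/2-\delta^3/3)/2}, $$ $$ R_2=2\left(M+K\left(1+\frac4\delta\right)^s\right)e^{-N\delta^2/4+N\delta^3/3}+2\left(1+\frac4\delta\right)^N e^{-M\delta^2/4+M\delta^3/3}. $$ 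-/

import Mathlib

open MeasureTheory ProbabilityTheory

/-- The uniform probability measure on the unit sphere of `ℝ^N`, as a measure on `ℝ^N`:
the rotation-invariant surface measure `volume.toSphere`, normalized to total mass one and
pushed forward along the inclusion of the sphere. -/
noncomputable def uniformSphere (N : ℕ) : Measure (EuclideanSpace ℝ (Fin N)) :=
  Measure.map Subtype.val
    (((volume : Measure (EuclideanSpace ℝ (Fin N))).toSphere Set.univ)⁻¹ •
      (volume : Measure (EuclideanSpace ℝ (Fin N))).toSphere)

/-- The orthogonal projection of `ℝ^N` onto the span of the vectors `v i`, `i ∈ J`. -/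
noncomputable def spanProj {N M : ℕ} (v : Fin M → EuclideanSpace ℝ (Fin N))
    (J : Finset (Fin M)) : EuclideanSpace ℝ (Fin N) →L[ℝ] EuclideanSpace ℝ (Fin N) :=
  (Submodule.span ℝ (v '' (J : Set (Fin M)))).starProjection

/-- The trace of a continuous linear operator on `ℝ^N`. -/
noncomputable def opTrace {N : ℕ}
    (T : EuclideanSpace ℝ (Fin N) →L[ℝ] EuclideanSpace ℝ (Fin N)) : ℝ :=
  LinearMap.trace ℝ (EuclideanSpace ℝ (Fin N)) T.toLinearMap

/-- The first term of the bound on the failure probability. -/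
noncomputable def failR₁ (s : ℕ) (δ : ℝ) : ℝ :=
  2 * (s : ℝ) * Real.exp ((1 + δ) * (s : ℝ) / 2
    - (s : ℝ) * ((s : ℝ) - 1) * (δ ^ 2 / 2 - δ ^ 3 / 3) / 2)

/-- The second term of the bound on the failure probability. -/
noncomputable def failR₂ (K s M N : ℕ) (δ : ℝ) : ℝ :=
  2 * ((M : ℝ) + (K : ℝ) * (1 + 4 / δ) ^ s) *
      Real.exp (-(N : ℝ) * δ ^ 2 / 4 + (N : ℝ) * δ ^ 3 / 3)
    + 2 * (1 + 4 / δ) ^ N * Real.exp (-(M : ℝ) * δ ^ 2 / 4 + (M : ℝ) * δ ^ 3 / 3)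

/-! The failure terms are generous enough that no concentration of the trace around 1 is needed. If
$9\delta^2N\le s$, then $R_2\ge 5^se^{-N\delta^2/4}\ge 1$ and the bound is vacuous. Otherwise
$\epsilon\sqrt{(1+\epsilon)N/s}\ge 1$, so the lower bound is at most 0 and holds because the trace
is nonnegative.

Only an upper tail remains. With Gram-Schmidt bases $a_j$, $b_i$ of the two spans, the trace is
$\sum_{i,j}\langle a_j,b_i\rangle^2$ (`opTrace_spanProj_mul`). The two families are independent, and
each $b_i$ is rotation invariant in the unit ball, hence subgaussian with variance proxy $1/N$
(`lintegral_exp_inner_le`). Gaussian linearization of the squares (`lintegral_exp_sum_inner_sq_le`)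
and Jensen over $i$ bound $\mathbb E\exp(\frac N{4s}\operatorname{tr})$ by $\sqrt2^{\,s}$. Markov's
inequality at $1+N\epsilon^2/(4s)$ then gives a probability below $R_2$. -/

open scoped Pointwise in
/-- The uniform measure on the sphere is invariant under linear isometries. -/
theorem uniformSphere_map_isometry {N : ℕ}
    (U : EuclideanSpace ℝ (Fin N) ≃ₗᵢ[ℝ] EuclideanSpace ℝ (Fin N)) :
    (uniformSphere N).map U = uniformSphere N := by
  -- Surface measure is $N$ times the volume of the cone over a set, so invariance reduces to that
  -- of Lebesgue measure.
  have key : ∀ A : Set (EuclideanSpace ℝ (Fin N)), MeasurableSet A →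
      uniformSphere N A = ((volume : Measure (EuclideanSpace ℝ (Fin N))).toSphere Set.univ)⁻¹ *
        (Module.finrank ℝ (EuclideanSpace ℝ (Fin N)) *
          volume (Set.Ioo (0 : ℝ) 1 • (A ∩ Metric.sphere (0 : EuclideanSpace ℝ (Fin N)) 1))) := by
    intro A hA
    rw [uniformSphere, Measure.map_apply measurable_subtype_coe hA, Measure.smul_apply,
      Measure.toSphere_apply' _ (measurable_subtype_coe hA), Subtype.image_preimage_coe,
      smul_eq_mul, Set.inter_comm]
  ext A hA
  rw [Measure.map_apply U.continuous.measurable hA, key _ hA,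
    key _ (U.continuous.measurable hA)]
  congr 2
  rw [← U.measurePreserving.measure_preimage_emb U.toHomeomorph.measurableEmbedding
    (Set.Ioo (0 : ℝ) 1 • (A ∩ Metric.sphere (0 : EuclideanSpace ℝ (Fin N)) 1))]
  congr 1
  ext y
  simp only [Set.mem_smul, Set.mem_preimage, Set.mem_inter_iff, mem_sphere_zero_iff_norm]
  constructor
  · rintro ⟨r, hr, z, ⟨hz, hz1⟩, rfl⟩
    exact ⟨r, hr, U z, ⟨hz, by simpa using hz1⟩, by simp⟩
  · rintro ⟨r, hr, z, ⟨hz, hz1⟩, h⟩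
    refine ⟨r, hr, U.symm z, ⟨by simpa using hz, by simpa using hz1⟩, ?_⟩
    rw [← map_smul, h]; simp

/-- Two vectors of the same norm are exchanged by a linear isometry. -/
theorem exists_isometry_map_eq {E : Type*} [NormedAddCommGroup E] [InnerProductSpace ℝ E]
    {v w : E} (h : ‖v‖ = ‖w‖) : ∃ U : E ≃ₗᵢ[ℝ] E, U v = w :=
  ⟨_, Submodule.reflection_sub h⟩

/-! ### Exponential moments of rotation-invariant vectors -/

theorem sum_exp_signs {N : ℕ} (c : ℝ) (a : Fin N → ℝ) :
    ∑ η : Fin N → Bool, Real.exp (∑ i, (if η i then c else -c) * a i) =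
      ∏ i, (2 * Real.cosh (c * a i)) := by
  have h : ∀ i, 2 * Real.cosh (c * a i) = ∑ b : Bool, Real.exp ((if b then c else -c) * a i) := by
    intro i
    rw [Real.cosh_eq]
    simp
    ring
  simp_rw [h]
  rw [Finset.prod_univ_sum]
  simp only [Fintype.piFinset_univ, Real.exp_sum]

/-- A rotation-invariant random vector in the unit ball of `ℝ^N` is subgaussian with variance
proxy `1 / N`. -/
theorem lintegral_exp_inner_le {N : ℕ} (hN : 0 < N) (ρ : Measure (EuclideanSpace ℝ (Fin N)))
    [IsProbabilityMeasure ρ]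
    (hρ : ∀ U : EuclideanSpace ℝ (Fin N) ≃ₗᵢ[ℝ] EuclideanSpace ℝ (Fin N), ρ.map U = ρ)
    (hb : ∀ᵐ e ∂ρ, ‖e‖ ≤ 1) (w : EuclideanSpace ℝ (Fin N)) :
    ∫⁻ e, ENNReal.ofReal (Real.exp (inner ℝ w e)) ∂ρ ≤
      ENNReal.ofReal (Real.exp (‖w‖ ^ 2 / (2 * N))) := by
  have hN' : (0 : ℝ) < N := by exact_mod_cast hN
  -- With this $c$ every vector with coordinates $\pm c$ has norm $\|w\|$, so invariance lets it
  -- replace $w$; averaging over all signs turns the exponential into a product of hyperbolic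
  -- cosines.
  set c : ℝ := ‖w‖ / √N with hc
  have hc2 : c ^ 2 = ‖w‖ ^ 2 / N := by rw [hc, div_pow, Real.sq_sqrt hN'.le]
  let W : (Fin N → Bool) → EuclideanSpace ℝ (Fin N) :=
    fun η => WithLp.toLp 2 fun i => if η i then c else -c
  have hW : ∀ η, ‖w‖ = ‖W η‖ := by
    intro η
    rw [EuclideanSpace.norm_eq (W η)]
    have : ∀ i, ‖(W η) i‖ ^ 2 = c ^ 2 := by
      intro i
      simp only [W]
      split_ifs <;> simp
    rw [Finset.sum_congr rfl fun i _ => this i, Finset.sum_const, Finset.card_univ, Fintype.card_fin, nsmul_eq_mul, hc2,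
      mul_div_cancel₀ _ hN'.ne', Real.sqrt_sq (norm_nonneg _)]
  have hinv : ∀ η, ∫⁻ e, ENNReal.ofReal (Real.exp (inner ℝ w e)) ∂ρ =
      ∫⁻ e, ENNReal.ofReal (Real.exp (inner ℝ (W η) e)) ∂ρ := by
    intro η
    obtain ⟨U, hU⟩ := exists_isometry_map_eq (hW η)
    conv_rhs => rw [← hρ U]
    rw [lintegral_map (by fun_prop) U.continuous.measurable]
    refine lintegral_congr fun e => ?_
    rw [← hU, LinearIsometryEquiv.inner_map_map]
  have hsum : (2 : ENNReal) ^ N * ∫⁻ e, ENNReal.ofReal (Real.exp (inner ℝ w e)) ∂ρ ≤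
      2 ^ N * ENNReal.ofReal (Real.exp (‖w‖ ^ 2 / (2 * N))) := by
    calc (2 : ENNReal) ^ N * ∫⁻ e, ENNReal.ofReal (Real.exp (inner ℝ w e)) ∂ρ
        = ∑ η : Fin N → Bool, ∫⁻ e, ENNReal.ofReal (Real.exp (inner ℝ (W η) e)) ∂ρ := by
          rw [Finset.sum_congr rfl fun η _ => (hinv η).symm]
          simp
      _ = ∫⁻ e, ENNReal.ofReal (∏ i, (2 * Real.cosh (c * e i))) ∂ρ := by
          rw [← lintegral_finsetSum _ (fun _ _ => by fun_prop)]
          congr with e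
          rw [← ENNReal.ofReal_sum_of_nonneg (fun _ _ => (Real.exp_pos _).le),
            ← sum_exp_signs c]
          congr 1
          refine Finset.sum_congr rfl fun η _ => ?_
          congr 1
          rw [PiLp.inner_apply]
          refine Finset.sum_congr rfl fun i _ => ?_
          simp [W, mul_comm]
      _ ≤ ∫⁻ _, 2 ^ N * ENNReal.ofReal (Real.exp (‖w‖ ^ 2 / (2 * N))) ∂ρ := by
          refine lintegral_mono_ae ?_
          filter_upwards [hb] with e he
          have h2 : (2 : ENNReal) ^ N = ENNReal.ofReal (2 ^ N) := by
            rw [ENNReal.ofReal_pow (by norm_num)]; simp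
          rw [h2, ← ENNReal.ofReal_mul (by positivity)]
          refine ENNReal.ofReal_le_ofReal ?_
          rw [Finset.prod_mul_distrib, Finset.prod_const, Finset.card_univ, Fintype.card_fin]
          gcongr
          calc ∏ i, Real.cosh (c * e i) ≤ ∏ i, Real.exp ((c * e i) ^ 2 / 2) :=
                Finset.prod_le_prod (fun _ _ => (Real.cosh_pos _).le)
                  fun _ _ => Real.cosh_le_exp_half_sq _
            _ = Real.exp (c ^ 2 / 2 * ‖e‖ ^ 2) := by
                rw [← Real.exp_sum, EuclideanSpace.norm_sq_eq, Finset.mul_sum]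
                congr 1
                refine Finset.sum_congr rfl fun i _ => ?_
                rw [Real.norm_eq_abs, sq_abs]
                ring
            _ ≤ Real.exp (‖w‖ ^ 2 / (2 * N)) := by
                refine Real.exp_le_exp.mpr ?_
                have : ‖e‖ ^ 2 ≤ 1 := pow_le_one₀ (norm_nonneg _) he
                calc c ^ 2 / 2 * ‖e‖ ^ 2 ≤ c ^ 2 / 2 * 1 := by gcongr
                  _ = _ := by rw [hc2]; field_simp
      _ = _ := by simp
  exact (ENNReal.mul_le_mul_iff_right (by simp) (by simp)).mp hsum

theorem lintegral_exp_mul_gaussianReal (t : ℝ) :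
    ∫⁻ g, ENNReal.ofReal (Real.exp (t * g)) ∂(gaussianReal 0 1) =
      ENNReal.ofReal (Real.exp (t ^ 2 / 2)) := by
  rw [← ofReal_integral_eq_lintegral_ofReal (integrable_exp_mul_gaussianReal t)
    (Filter.Eventually.of_forall fun _ => (Real.exp_pos _).le)]
  have := congrFun (mgf_id_gaussianReal (μ := 0) (v := 1)) t
  simp only [mgf, id] at this
  rw [this]
  simp

theorem lintegral_exp_sq_div_four_gaussianReal :
    ∫⁻ g, ENNReal.ofReal (Real.exp (g ^ 2 / 4)) ∂(gaussianReal 0 1) = ENNReal.ofReal √2 := by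
  rw [gaussianReal_of_var_ne_zero _ one_ne_zero,
    lintegral_withDensity_eq_lintegral_mul _ (measurable_gaussianPDF _ _) (by fun_prop)]
  have h : ∀ g : ℝ, (gaussianPDF 0 1 * fun g => ENNReal.ofReal (Real.exp (g ^ 2 / 4))) g =
      ENNReal.ofReal ((√(2 * Real.pi))⁻¹ * Real.exp (-(1 / 4) * g ^ 2)) := by
    intro g
    rw [Pi.mul_apply, gaussianPDF, ← ENNReal.ofReal_mul (gaussianPDFReal_nonneg _ _ _),
      gaussianPDFReal, mul_assoc, ← Real.exp_add]
    simp
    congr 3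
    ring
  simp_rw [h]
  rw [← ofReal_integral_eq_lintegral_ofReal
    ((integrable_exp_neg_mul_sq (by norm_num)).const_mul _)
    (Filter.Eventually.of_forall fun _ => by positivity), integral_const_mul, integral_gaussian]
  congr 1
  rw [← Real.sqrt_inv, ← Real.sqrt_mul (by positivity)]
  congr 1
  field_simp
  norm_num

theorem lintegral_pi_prod {ι : Type*} [Fintype ι] {X : ι → Type*} [∀ i, MeasurableSpace (X i)]
    (ρ : ∀ i, Measure (X i)) [∀ i, IsProbabilityMeasure (ρ i)] (f : ∀ i, X i → ENNReal)
    (hf : ∀ i, Measurable (f i)) :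
    ∫⁻ x, ∏ i, f i (x i) ∂(Measure.pi ρ) = ∏ i, ∫⁻ y, f i y ∂(ρ i) := by
  have h := lintegral_prod_eq_prod_lintegral_of_indepFun (μ := Measure.pi ρ) Finset.univ
    (fun i x => f i (x i)) (iIndepFun_pi fun i => (hf i).aemeasurable)
    fun i => (hf i).comp (measurable_pi_apply i)
  rw [h]
  refine Finset.prod_congr rfl fun i _ => ?_
  exact (measurePreserving_eval ρ i).lintegral_comp (hf i)

/-- Exponential moment of the squared length of the projection of a rotation-invariant random
vector in the unit ball, along at most `s` orthogonal directions. -/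
theorem lintegral_exp_sum_inner_sq_le {N s : ℕ} (hN : 0 < N)
    (ρ : Measure (EuclideanSpace ℝ (Fin N))) [IsProbabilityMeasure ρ]
    (hρ : ∀ U : EuclideanSpace ℝ (Fin N) ≃ₗᵢ[ℝ] EuclideanSpace ℝ (Fin N), ρ.map U = ρ)
    (hb : ∀ᵐ e ∂ρ, ‖e‖ ≤ 1) (f : Fin s → EuclideanSpace ℝ (Fin N))
    (hf : ∀ i j, i ≠ j → inner ℝ (f i) (f j) = 0) (hf1 : ∀ i, ‖f i‖ ≤ 1) :
    ∫⁻ e, ENNReal.ofReal (Real.exp (N / 4 * ∑ j, inner ℝ (f j) e ^ 2)) ∂ρ ≤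
      ENNReal.ofReal (√2 ^ s) := by
  have hN' : (0 : ℝ) < N := by exact_mod_cast hN
  set γ : Measure (Fin s → ℝ) := Measure.pi fun _ => gaussianReal 0 1 with hγ
  -- Since $\mathbb E e^{tg}=e^{t^2/2}$ for a standard Gaussian $g$, taking $t=r\langle
  -- f_j,e\rangle$ with $r^2/2=N/4$ makes the exponent linear in $e$.
  set r : ℝ := √(N / 2) with hr
  have hr2 : r ^ 2 = N / 2 := Real.sq_sqrt (by positivity)
  have hlin : ∀ e : EuclideanSpace ℝ (Fin N),
      ENNReal.ofReal (Real.exp (N / 4 * ∑ j, inner ℝ (f j) e ^ 2)) =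
        ∫⁻ g, ENNReal.ofReal (Real.exp (inner ℝ (∑ j, (r * g j) • f j) e)) ∂γ := by
    intro e
    have h1 : ∀ g : Fin s → ℝ,
        ENNReal.ofReal (Real.exp (inner ℝ (∑ j, (r * g j) • f j) e)) =
          ∏ j, ENNReal.ofReal (Real.exp ((r * inner ℝ (f j) e) * g j)) := by
      intro g
      rw [← ENNReal.ofReal_prod_of_nonneg (fun _ _ => (Real.exp_pos _).le), ← Real.exp_sum,
        sum_inner]
      congr 2
      refine Finset.sum_congr rfl fun j _ => ?_
      rw [real_inner_smul_left]
      ring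
    simp_rw [h1]
    rw [hγ, lintegral_pi_prod _ (fun j y => ENNReal.ofReal (Real.exp ((r * inner ℝ (f j) e) * y)))
      (fun _ => by fun_prop)]
    simp_rw [lintegral_exp_mul_gaussianReal]
    rw [← ENNReal.ofReal_prod_of_nonneg (fun _ _ => (Real.exp_pos _).le), ← Real.exp_sum,
      Finset.mul_sum]
    congr 2
    refine Finset.sum_congr rfl fun j _ => ?_
    rw [mul_pow, hr2]
    ring
  have hnorm : ∀ g : Fin s → ℝ, ‖∑ j, (r * g j) • f j‖ ^ 2 ≤ N / 2 * ∑ j, g j ^ 2 := by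
    intro g
    rw [← real_inner_self_eq_norm_sq, sum_inner, Finset.mul_sum]
    refine Finset.sum_le_sum fun i _ => ?_
    rw [inner_sum, Finset.sum_eq_single i]
    · rw [real_inner_smul_left, real_inner_smul_right, real_inner_self_eq_norm_sq]
      have h1 : ‖f i‖ ^ 2 ≤ 1 := pow_le_one₀ (norm_nonneg _) (hf1 i)
      calc r * g i * (r * g i * ‖f i‖ ^ 2) = (r * g i) ^ 2 * ‖f i‖ ^ 2 := by ring
        _ ≤ (r * g i) ^ 2 * 1 := by gcongr
        _ = _ := by rw [mul_pow, hr2]; ring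
    · intro j _ hj
      rw [real_inner_smul_left, real_inner_smul_right, hf i j hj.symm]
      simp
    · simp
  simp_rw [hlin]
  rw [lintegral_lintegral_swap (by fun_prop)]
  calc ∫⁻ g, ∫⁻ e, ENNReal.ofReal (Real.exp (inner ℝ (∑ j, (r * g j) • f j) e)) ∂ρ ∂γ
      ≤ ∫⁻ g, ∏ j, ENNReal.ofReal (Real.exp (g j ^ 2 / 4)) ∂γ := by
        refine lintegral_mono fun g => (lintegral_exp_inner_le hN ρ hρ hb _).trans ?_
        rw [← ENNReal.ofReal_prod_of_nonneg (fun _ _ => (Real.exp_pos _).le), ← Real.exp_sum]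
        refine ENNReal.ofReal_le_ofReal (Real.exp_le_exp.mpr ?_)
        calc ‖∑ j, (r * g j) • f j‖ ^ 2 / (2 * N) ≤ N / 2 * (∑ j, g j ^ 2) / (2 * N) := by
              gcongr; exact hnorm g
          _ = _ := by
              rw [← Finset.sum_div]
              field_simp
              ring
    _ = ENNReal.ofReal (√2 ^ s) := by
        rw [hγ, lintegral_pi_prod _ (fun _ y => ENNReal.ofReal (Real.exp (y ^ 2 / 4)))
          (fun _ => by fun_prop)]
        simp_rw [lintegral_exp_sq_div_four_gaussianReal]
        rw [Finset.prod_const, Finset.card_univ, Fintype.card_fin,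
          ENNReal.ofReal_pow (Real.sqrt_nonneg _)]

/-! ### Gram-Schmidt: projections, equivariance, measurability -/

section GramSchmidt

open InnerProductSpace

variable {E : Type*} [NormedAddCommGroup E] [InnerProductSpace ℝ E] {s : ℕ}

theorem norm_gramSchmidtNormed_le_one (f : Fin s → E) (i : Fin s) :
    ‖gramSchmidtNormed ℝ f i‖ ≤ 1 := by
  by_cases h : gramSchmidtNormed ℝ f i = 0
  · simp [h]
  · exact (gramSchmidtNormed_unit_length' h).le

theorem inner_gramSchmidtNormed_eq_zero (f : Fin s → E) {i j : Fin s} (hij : i ≠ j) :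
    inner ℝ (gramSchmidtNormed ℝ f i) (gramSchmidtNormed ℝ f j) = 0 := by
  simp [gramSchmidtNormed, inner_smul_left, inner_smul_right, gramSchmidt_orthogonal ℝ f hij]

/-- Covers unit vectors and the zero vectors produced by linear dependence alike, so almost sure
independence of the $x_i$ is never needed. -/
theorem inner_gramSchmidtNormed_self_smul (f : Fin s → E) (i : Fin s) :
    inner ℝ (gramSchmidtNormed ℝ f i) (gramSchmidtNormed ℝ f i) • gramSchmidtNormed ℝ f i =
      gramSchmidtNormed ℝ f i := by
  by_cases h : gramSchmidtNormed ℝ f i = 0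
  · simp [h]
  · rw [real_inner_self_eq_norm_sq, gramSchmidtNormed_unit_length' h]
    simp

theorem starProjection_span_range_eq_sum [FiniteDimensional ℝ E] (f : Fin s → E) :
    (Submodule.span ℝ (Set.range f)).starProjection =
      ∑ i, rankOne ℝ (gramSchmidtNormed ℝ f i) (gramSchmidtNormed ℝ f i) := by
  set e := gramSchmidtNormed ℝ f with he
  have hspan : Submodule.span ℝ (Set.range f) = Submodule.span ℝ (Set.range e) := by
    rw [he, span_gramSchmidtNormed_range, span_gramSchmidt]
  rw [hspan]
  ext x
  simp only [_root_.sum_apply, rankOne_apply]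
  refine Submodule.eq_starProjection_of_mem_of_inner_eq_zero ?_ ?_
  · exact Submodule.sum_mem _ fun i _ =>
      Submodule.smul_mem _ _ (Submodule.subset_span (Set.mem_range_self i))
  · intro w hw
    induction hw using Submodule.span_induction with
    | mem w hw =>
      obtain ⟨j, rfl⟩ := hw
      rw [inner_sub_left, sum_inner, Finset.sum_eq_single j, ← real_inner_comm, sub_eq_zero]
      · conv_lhs => rw [he, ← inner_gramSchmidtNormed_self_smul f j]
        rw [real_inner_smul_left, real_inner_smul_left, mul_comm]
      · intro i _ hij
        rw [real_inner_smul_left, inner_gramSchmidtNormed_eq_zero f hij, mul_zero]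
      · simp
    | zero => simp
    | add a b _ _ ha hb => rw [inner_add_right, ha, hb, add_zero]
    | smul c a _ ha => rw [real_inner_smul_right, ha, mul_zero]

/-- The recursion uses only inner products, norms and linear combinations. This passes rotation
invariance from a family to each of its orthonormalized vectors. -/
theorem gramSchmidt_comp_isometry (U : E ≃ₗᵢ[ℝ] E) (f : Fin s → E) (n : Fin s) :
    gramSchmidt ℝ (fun i => U (f i)) n = U (gramSchmidt ℝ f n) := by
  induction n using WellFoundedLT.induction with
  | ind n ih =>
    rw [← sub_eq_iff_eq_add.mpr (gramSchmidt_def'' ℝ (fun i => U (f i)) n),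
      ← sub_eq_iff_eq_add.mpr (gramSchmidt_def'' ℝ f n), map_sub, map_sum]
    congr 1
    refine Finset.sum_congr rfl fun i hi => ?_
    rw [ih i (Finset.mem_Iio.mp hi), map_smul, U.inner_map_map, U.norm_map]

theorem gramSchmidtNormed_comp_isometry (U : E ≃ₗᵢ[ℝ] E) (f : Fin s → E) (n : Fin s) :
    gramSchmidtNormed ℝ (fun i => U (f i)) n = U (gramSchmidtNormed ℝ f n) := by
  simp [gramSchmidtNormed, gramSchmidt_comp_isometry]

theorem measurable_gramSchmidtNormed [FiniteDimensional ℝ E] [MeasurableSpace E] [BorelSpace E]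
    (n : Fin s) : Measurable fun f : Fin s → E => gramSchmidtNormed ℝ f n := by
  have h : Measurable fun f : Fin s → E => gramSchmidt ℝ f n := by
    induction n using WellFoundedLT.induction with
    | ind n ih =>
      have : (fun f : Fin s → E => gramSchmidt ℝ f n) = fun f => f n -
          ∑ i ∈ Finset.Iio n, (inner ℝ (gramSchmidt ℝ f i) (f n) /
            (‖gramSchmidt ℝ f i‖ : ℝ) ^ 2) • gramSchmidt ℝ f i := by
        funext f
        exact (sub_eq_iff_eq_add.mpr (gramSchmidt_def'' ℝ f n)).symm
      rw [this]
      refine (measurable_pi_apply n).sub (Finset.measurable_fun_sum _ fun i hi => ?_)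
      have hi := ih i (Finset.mem_Iio.mp hi)
      exact ((hi.inner (measurable_pi_apply n)).div (hi.norm.pow_const 2)).smul hi
  exact (h.norm.inv).smul h

end GramSchmidt

/-! ### Trace as overlap, and the tail of the overlap -/

/-- The sum of squared inner products of the Gram-Schmidt orthonormalizations of two families. -/
noncomputable def gramSchmidtOverlap {N s : ℕ} (a b : Fin s → EuclideanSpace ℝ (Fin N)) : ℝ :=
  ∑ i, ∑ j, inner ℝ (InnerProductSpace.gramSchmidtNormed ℝ a j)
    (InnerProductSpace.gramSchmidtNormed ℝ b i) ^ 2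

theorem gramSchmidtOverlap_nonneg {N s : ℕ} (a b : Fin s → EuclideanSpace ℝ (Fin N)) :
    0 ≤ gramSchmidtOverlap a b :=
  Finset.sum_nonneg fun _ _ => Finset.sum_nonneg fun _ _ => sq_nonneg _

theorem measurable_gramSchmidtOverlap {N s : ℕ} :
    Measurable fun p : (Fin s → EuclideanSpace ℝ (Fin N)) × (Fin s → EuclideanSpace ℝ (Fin N)) =>
      gramSchmidtOverlap p.1 p.2 := by
  refine Finset.measurable_fun_sum _ fun i _ => Finset.measurable_fun_sum _ fun j _ => ?_
  exact (((measurable_gramSchmidtNormed j).comp measurable_fst).inner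
    ((measurable_gramSchmidtNormed i).comp measurable_snd)).pow_const 2

theorem spanProj_eq_starProjection {N M s : ℕ} (v : Fin M → EuclideanSpace ℝ (Fin N))
    (J : Finset (Fin M)) (hJ : J.card = s) :
    spanProj v J = (Submodule.span ℝ
      (Set.range fun i : Fin s => v (J.orderEmbOfFin hJ i))).starProjection := by
  have h : v '' (J : Set (Fin M)) = Set.range fun i : Fin s => v (J.orderEmbOfFin hJ i) := by
    rw [← Finset.range_orderEmbOfFin J hJ, ← Set.range_comp]
    rfl
  simp only [spanProj, h]

theorem opTrace_spanProj_mul {N M s : ℕ} (v : Fin M → EuclideanSpace ℝ (Fin N))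
    (I J : Finset (Fin M)) (hI : I.card = s) (hJ : J.card = s) :
    opTrace (spanProj v I * spanProj v J) =
      gramSchmidtOverlap (fun i => v (I.orderEmbOfFin hI i))
        (fun i => v (J.orderEmbOfFin hJ i)) := by
  rw [spanProj_eq_starProjection v I hI, spanProj_eq_starProjection v J hJ,
    starProjection_span_range_eq_sum, starProjection_span_range_eq_sum, opTrace,
    gramSchmidtOverlap, Finset.sum_mul_sum, Finset.sum_comm]
  simp only [ContinuousLinearMap.toLinearMap_sum, map_sum]
  refine Finset.sum_congr rfl fun i _ => Finset.sum_congr rfl fun j _ => ?_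
  rw [ContinuousLinearMap.mul_def, InnerProductSpace.rankOne_comp_rankOne,
    ContinuousLinearMap.toLinearMap_smul, map_smul, InnerProductSpace.trace_rankOne, smul_eq_mul,
    real_inner_comm, sq]

/-- Jensen for the average over $i$: the $b_i$ are mutually dependent, and this leaves one of them
at a time. -/
theorem exp_gramSchmidtOverlap_le {N s : ℕ} (hs : 0 < s)
    (a b : Fin s → EuclideanSpace ℝ (Fin N)) :
    Real.exp (N / (4 * s) * gramSchmidtOverlap a b) ≤
      ∑ i, (s : ℝ)⁻¹ * Real.exp (N / 4 *
        ∑ j, inner ℝ (InnerProductSpace.gramSchmidtNormed ℝ a j)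
          (InnerProductSpace.gramSchmidtNormed ℝ b i) ^ 2) := by
  have hs' : (0 : ℝ) < s := by exact_mod_cast hs
  have h := convexOn_exp.map_sum_le (t := Finset.univ) (w := fun _ : Fin s => (s : ℝ)⁻¹)
    (p := fun i => N / 4 * ∑ j, inner ℝ (InnerProductSpace.gramSchmidtNormed ℝ a j)
      (InnerProductSpace.gramSchmidtNormed ℝ b i) ^ 2)
    (fun _ _ => by positivity) (by simp [hs'.ne']) (fun _ _ => Set.mem_univ _)
  simp only [smul_eq_mul] at h
  refine le_of_eq_of_le ?_ h
  rw [gramSchmidtOverlap, ← Finset.mul_sum, ← Finset.mul_sum, ← mul_assoc]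
  congr 2
  field_simp

/-- Exponential moment of the overlap of a fixed family with a random family whose law is
invariant under linear isometries. -/
theorem lintegral_exp_gramSchmidtOverlap_le {N s : ℕ} (hN : 0 < N) (hs : 0 < s)
    (ν : Measure (Fin s → EuclideanSpace ℝ (Fin N))) [IsProbabilityMeasure ν]
    (hν : ∀ U : EuclideanSpace ℝ (Fin N) ≃ₗᵢ[ℝ] EuclideanSpace ℝ (Fin N),
      ν.map (fun b i => U (b i)) = ν)
    (a : Fin s → EuclideanSpace ℝ (Fin N)) :
    ∫⁻ b, ENNReal.ofReal (Real.exp (N / (4 * s) * gramSchmidtOverlap a b)) ∂ν ≤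
      ENNReal.ofReal (√2 ^ s) := by
  have hs' : (0 : ℝ) < s := by exact_mod_cast hs
  set F : EuclideanSpace ℝ (Fin N) → ENNReal := fun e => ENNReal.ofReal (Real.exp (N / 4 *
    ∑ j, inner ℝ (InnerProductSpace.gramSchmidtNormed ℝ a j) e ^ 2)) with hF
  have hFm : Measurable F := by fun_prop
  have hFi : ∀ i : Fin s, Measurable fun b => F (InnerProductSpace.gramSchmidtNormed ℝ b i) :=
    fun i => hFm.comp (measurable_gramSchmidtNormed i)
  have hone : ∀ i, ∫⁻ b, F (InnerProductSpace.gramSchmidtNormed ℝ b i) ∂ν ≤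
      ENNReal.ofReal (√2 ^ s) := by
    intro i
    have hm := measurable_gramSchmidtNormed (E := EuclideanSpace ℝ (Fin N)) i
    rw [← lintegral_map (f := F) hFm hm]
    have : IsProbabilityMeasure
        (ν.map fun b => InnerProductSpace.gramSchmidtNormed ℝ b i) :=
      Measure.isProbabilityMeasure_map hm.aemeasurable
    refine lintegral_exp_sum_inner_sq_le hN _ (fun U => ?_) ?_ _
      (fun _ _ => inner_gramSchmidtNormed_eq_zero a) (norm_gramSchmidtNormed_le_one a)
    · have hU : Measurable fun (b : Fin s → EuclideanSpace ℝ (Fin N)) i => U (b i) :=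
        measurable_pi_lambda _ fun i => U.continuous.measurable.comp (measurable_pi_apply i)
      conv_rhs => rw [← hν U, Measure.map_map hm hU]
      rw [Measure.map_map U.continuous.measurable hm]
      congr 1
      funext b
      exact (gramSchmidtNormed_comp_isometry U b i).symm
    · rw [ae_map_iff hm.aemeasurable (measurableSet_le measurable_norm measurable_const)]
      exact Filter.Eventually.of_forall fun b => norm_gramSchmidtNormed_le_one b i
  calc ∫⁻ b, ENNReal.ofReal (Real.exp (N / (4 * s) * gramSchmidtOverlap a b)) ∂ν
      ≤ ∫⁻ b, ∑ i, ENNReal.ofReal (s : ℝ)⁻¹ *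
          F (InnerProductSpace.gramSchmidtNormed ℝ b i) ∂ν := by
        refine lintegral_mono fun b => ?_
        refine (ENNReal.ofReal_le_ofReal (exp_gramSchmidtOverlap_le hs a b)).trans ?_
        rw [ENNReal.ofReal_sum_of_nonneg fun _ _ => by positivity]
        simp_rw [hF, ENNReal.ofReal_mul (inv_nonneg.mpr hs'.le)]
        exact le_rfl
    _ = ∑ i, ENNReal.ofReal (s : ℝ)⁻¹ *
          ∫⁻ b, F (InnerProductSpace.gramSchmidtNormed ℝ b i) ∂ν := by
        rw [lintegral_finsetSum _ fun i _ => (hFi i).const_mul _]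
        exact Finset.sum_congr rfl fun i _ => lintegral_const_mul _ (hFi i)
    _ ≤ ∑ _i : Fin s, ENNReal.ofReal (s : ℝ)⁻¹ * ENNReal.ofReal (√2 ^ s) :=
        Finset.sum_le_sum fun i _ => mul_le_mul_right (hone i) _
    _ = ENNReal.ofReal (√2 ^ s) := by
        rw [Finset.sum_const, Finset.card_univ, Fintype.card_fin, nsmul_eq_mul, ← mul_assoc,
          ← ENNReal.ofReal_natCast, ← ENNReal.ofReal_mul hs'.le, mul_inv_cancel₀ hs'.ne',
          ENNReal.ofReal_one, one_mul]

/-- Tail bound for the overlap of two independent random families, the second one having a law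
invariant under linear isometries. -/
theorem measureReal_gramSchmidtOverlap_ge_le {Ω : Type*} [MeasurableSpace Ω] (μ : Measure Ω)
    [IsProbabilityMeasure μ] {N s : ℕ} (hN : 0 < N) (hs : 0 < s)
    {A B : Ω → Fin s → EuclideanSpace ℝ (Fin N)} (hA : AEMeasurable A μ) (hB : AEMeasurable B μ)
    (hAB : IndepFun A B μ)
    (hinv : ∀ U : EuclideanSpace ℝ (Fin N) ≃ₗᵢ[ℝ] EuclideanSpace ℝ (Fin N),
      (μ.map B).map (fun b i => U (b i)) = μ.map B) (t : ℝ) :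
    μ.real {ω | t ≤ N / (s : ℝ) ^ 2 * gramSchmidtOverlap (A ω) (B ω)} ≤
      Real.exp (-(s * t / 4)) * √2 ^ s := by
  have hs' : (0 : ℝ) < s := by exact_mod_cast hs
  have := Measure.isProbabilityMeasure_map hA
  have := Measure.isProbabilityMeasure_map hB
  set G : (Fin s → EuclideanSpace ℝ (Fin N)) × (Fin s → EuclideanSpace ℝ (Fin N)) → ENNReal :=
    fun p => ENNReal.ofReal (Real.exp (N / (4 * s) * gramSchmidtOverlap p.1 p.2)) with hG
  have hGm : Measurable G :=
    (Real.measurable_exp.comp (measurable_gramSchmidtOverlap.const_mul _)).ennreal_ofReal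
  have hABm : AEMeasurable (fun ω => (A ω, B ω)) μ := hA.prodMk hB
  have hint : ∫⁻ ω, G (A ω, B ω) ∂μ ≤ ENNReal.ofReal (√2 ^ s) := by
    rw [← lintegral_map' (f := G) hGm.aemeasurable hABm,
      (indepFun_iff_map_prod_eq_prod_map_map hA hB).mp hAB,
      lintegral_prod _ hGm.aemeasurable]
    calc ∫⁻ a, ∫⁻ b, G (a, b) ∂(μ.map B) ∂(μ.map A)
        ≤ ∫⁻ _, ENNReal.ofReal (√2 ^ s) ∂(μ.map A) :=
          lintegral_mono fun a => lintegral_exp_gramSchmidtOverlap_le hN hs _ hinv a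
      _ = _ := by simp
  have hsub : {ω | t ≤ N / (s : ℝ) ^ 2 * gramSchmidtOverlap (A ω) (B ω)} ⊆
      {ω | ENNReal.ofReal (Real.exp (s * t / 4)) ≤ G (A ω, B ω)} := by
    intro ω hω
    refine ENNReal.ofReal_le_ofReal (Real.exp_le_exp.mpr ?_)
    have h : s / 4 * t ≤ s / 4 * (N / (s : ℝ) ^ 2 * gramSchmidtOverlap (A ω) (B ω)) :=
      mul_le_mul_of_nonneg_left hω (by positivity)
    calc s * t / 4 = s / 4 * t := by ring
      _ ≤ _ := h
      _ = _ := by field_simp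
  have hmarkov := (mul_meas_ge_le_lintegral₀ (hGm.comp_aemeasurable hABm)
    (ENNReal.ofReal (Real.exp (s * t / 4)))).trans hint
  have hreal : Real.exp (s * t / 4) *
      μ.real {ω | t ≤ N / (s : ℝ) ^ 2 * gramSchmidtOverlap (A ω) (B ω)} ≤ √2 ^ s := by
    rw [← ENNReal.ofReal_le_ofReal_iff (by positivity), ENNReal.ofReal_mul (Real.exp_pos _).le,
      ofReal_measureReal]
    exact (mul_le_mul_right (measure_mono hsub) _).trans hmarkov
  rw [Real.exp_neg, ← div_eq_inv_mul, le_div_iff₀ (Real.exp_pos _), mul_comm]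
  exact hreal

/-- The law of a family of independent uniform points of the sphere is invariant under linear
isometries. -/
theorem map_isometry_map_eq_of_iIndepFun {Ω ι : Type*} [Fintype ι] [MeasurableSpace Ω]
    {μ : Measure Ω} [IsProbabilityMeasure μ] {N : ℕ} {y : ι → Ω → EuclideanSpace ℝ (Fin N)}
    (hy : iIndepFun y μ) (hlaw : ∀ i, HasLaw (y i) (uniformSphere N) μ)
    (U : EuclideanSpace ℝ (Fin N) ≃ₗᵢ[ℝ] EuclideanSpace ℝ (Fin N)) :
    (μ.map fun ω i => y i ω).map (fun b i => U (b i)) = μ.map fun ω i => y i ω := by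
  rw [(iIndepFun_iff_map_fun_eq_pi_map fun i => (hlaw i).aemeasurable).mp hy]
  have : ∀ i, IsProbabilityMeasure (μ.map (y i)) := fun i =>
    Measure.isProbabilityMeasure_map (hlaw i).aemeasurable
  refine (measurePreserving_pi (fun i => μ.map (y i)) (fun i => μ.map (y i)) (f := fun _ => U)
    fun i => ⟨U.continuous.measurable, ?_⟩).map_eq
  rw [(hlaw i).map_eq, uniformSphere_map_isometry]

/-! ### Comparison with the failure terms and conclusion -/

theorem failR₁_nonneg (s : ℕ) (δ : ℝ) : 0 ≤ failR₁ s δ := by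
  unfold failR₁
  positivity

/-- Only the net term $K(1+4/\delta)^s$ matters: $1+4/\delta\ge 5$, and the $\delta^3$ term only
enlarges the exponential. -/
theorem le_failR₂ {K s M N : ℕ} {δ : ℝ} (hK : 0 < K) (hδ0 : 0 < δ) (hδ1 : δ < 1) :
    5 ^ s * Real.exp (-(N * δ ^ 2 / 4)) ≤ failR₂ K s M N δ := by
  have h5 : (5 : ℝ) ≤ 1 + 4 / δ := by
    have : 4 ≤ 4 / δ := by rw [le_div_iff₀ hδ0]; linarith
    linarith
  have hK' : (1 : ℝ) ≤ K := by exact_mod_cast hK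
  have hpow : (5 : ℝ) ^ s ≤ (1 + 4 / δ) ^ s := by gcongr
  have hcoef : (5 : ℝ) ^ s ≤ 2 * ((M : ℝ) + (K : ℝ) * (1 + 4 / δ) ^ s) := by
    have h0 : (0 : ℝ) ≤ (1 + 4 / δ) ^ s := by positivity
    nlinarith [mul_le_mul_of_nonneg_right hK' h0, Nat.cast_nonneg (α := ℝ) M]
  have hexp : Real.exp (-(N * δ ^ 2 / 4)) ≤
      Real.exp (-(N : ℝ) * δ ^ 2 / 4 + (N : ℝ) * δ ^ 3 / 3) := by
    refine Real.exp_le_exp.mpr ?_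
    have : (0 : ℝ) ≤ N * δ ^ 3 / 3 := by positivity
    linarith
  unfold failR₂
  have h2 : 0 ≤ 2 * (1 + 4 / δ) ^ N *
      Real.exp (-(M : ℝ) * δ ^ 2 / 4 + (M : ℝ) * δ ^ 3 / 3) := by positivity
  have h1 := mul_le_mul hcoef hexp (Real.exp_pos _).le (by positivity)
  linarith

theorem one_le_five_pow_mul_exp {s : ℕ} {a : ℝ} (h : a ≤ s) : 1 ≤ 5 ^ s * Real.exp (-a) := by
  have h5 : Real.exp s ≤ 5 ^ s := by
    rw [← Real.exp_one_pow]
    exact pow_le_pow_left₀ (Real.exp_pos _).le (by linarith [Real.exp_one_lt_d9]) s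
  calc (1 : ℝ) ≤ Real.exp (s + -a) := Real.one_le_exp (by linarith)
    _ = Real.exp s * Real.exp (-a) := Real.exp_add _ _
    _ ≤ _ := by gcongr

theorem lemma4p4 {Ω : Type*} [MeasurableSpace Ω] (μ : Measure Ω) [IsProbabilityMeasure μ]
    (K s M N : ℕ) (hs : 0 < s) (hM : M = K * s) (hNM : N ≤ M) (hsN : s ≤ N)
    (δ ε : ℝ) (hδ0 : 0 < δ) (hδ1 : δ < 1) (hε : ε = (1 + δ) ^ 3 - 1)
    (x : Fin M → Ω → EuclideanSpace ℝ (Fin N))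
    (hx_indep : iIndepFun x μ)
    (hx_unif : ∀ i, HasLaw (x i) (uniformSphere N) μ)
    (J : Fin K → Finset (Fin M))
    (hJ_disj : ∀ a b, a ≠ b → Disjoint (J a) (J b))
    (hJ_cover : ∀ i, ∃ a, i ∈ J a)
    (hJ_card : ∀ a, (J a).card = s)
    (k l : Fin K) (hkl : k ≠ l) :
    1 - failR₁ s δ - failR₂ K s M N δ ≤
      μ.real {ω |
        1 / (1 + ε) - ε * √((1 + ε) * (N : ℝ) / (s : ℝ)) ≤
            (N : ℝ) / (s : ℝ) ^ 2 *
              opTrace (spanProj (fun i => x i ω) (J l) * spanProj (fun i => x i ω) (J k)) ∧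
          (N : ℝ) / (s : ℝ) ^ 2 *
              opTrace (spanProj (fun i => x i ω) (J l) * spanProj (fun i => x i ω) (J k)) ≤
            1 + ε * (1 + √((1 + ε) * (N : ℝ) / (s : ℝ))) + (N : ℝ) * ε ^ 2 / (4 * (s : ℝ))} := by
  have hN : 0 < N := hs.trans_le hsN
  have hs' : (0 : ℝ) < s := by exact_mod_cast hs
  have hN' : (0 : ℝ) < N := by exact_mod_cast hN
  have hε3 : 3 * δ ≤ ε := by rw [hε]; nlinarith [pow_pos hδ0 2, pow_pos hδ0 3]
  have hε0 : 0 < ε := by linarith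
  have hR2 : 5 ^ s * Real.exp (-(N * δ ^ 2 / 4)) ≤ failR₂ K s M N δ :=
    le_failR₂ k.pos hδ0 hδ1
  have hR1 := failR₁_nonneg s δ
  -- The threshold comes from $\epsilon\ge 3\delta$: above it the lower bound is nonpositive, below
  -- it $N\delta^2/4\le s/36$ and $R_2\ge 1$.
  rcases le_or_gt (9 * δ ^ 2 * (N : ℝ)) (s : ℝ) with hsmall | hlarge
  · have h1 : (1 : ℝ) ≤ 5 ^ s * Real.exp (-(N * δ ^ 2 / 4)) :=
      one_le_five_pow_mul_exp (by nlinarith [mul_pos hN' (pow_pos hδ0 2)])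
    refine le_trans ?_ measureReal_nonneg
    linarith
  simp_rw [opTrace_spanProj_mul _ (J l) (J k) (hJ_card l) (hJ_card k)]
  set A : Ω → Fin s → EuclideanSpace ℝ (Fin N) :=
    fun ω i => x ((J l).orderEmbOfFin (hJ_card l) i) ω with hAdef
  set B : Ω → Fin s → EuclideanSpace ℝ (Fin N) :=
    fun ω i => x ((J k).orderEmbOfFin (hJ_card k) i) ω with hBdef
  have hmeas : ∀ i, AEMeasurable (x i) μ := fun i => (hx_unif i).aemeasurable
  have hA : AEMeasurable A μ := aemeasurable_pi_lambda _ fun i => hmeas _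
  have hB : AEMeasurable B μ := aemeasurable_pi_lambda _ fun i => hmeas _
  have hAB : IndepFun A B μ := by
    have h := hx_indep.indepFun_finset₀ (J l) (J k) (hJ_disj l k hkl.symm) hmeas
    exact h.comp
      (φ := fun (a : J l → EuclideanSpace ℝ (Fin N)) (i : Fin s) =>
        a ⟨(J l).orderEmbOfFin (hJ_card l) i, Finset.orderEmbOfFin_mem _ _ _⟩)
      (ψ := fun (a : J k → EuclideanSpace ℝ (Fin N)) (i : Fin s) =>
        a ⟨(J k).orderEmbOfFin (hJ_card k) i, Finset.orderEmbOfFin_mem _ _ _⟩)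
      (measurable_pi_lambda _ fun i => measurable_pi_apply _)
      (measurable_pi_lambda _ fun i => measurable_pi_apply _)
  have hinv : ∀ U : EuclideanSpace ℝ (Fin N) ≃ₗᵢ[ℝ] EuclideanSpace ℝ (Fin N),
      (μ.map B).map (fun b i => U (b i)) = μ.map B :=
    map_isometry_map_eq_of_iIndepFun
      (hx_indep.precomp ((J k).orderEmbOfFin (hJ_card k)).injective) fun i => hx_unif _
  set t : ℝ := 1 + N * ε ^ 2 / (4 * s) with ht
  have htail := measureReal_gramSchmidtOverlap_ge_le μ hN hs hA hB hAB hinv t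
  -- Here $st\ge N\epsilon^2/4\ge 9N\delta^2/4$, more than the required $N\delta^2$.
  have hst : N * δ ^ 2 / 4 ≤ s * t / 4 := by
    have h1 : s * t = s + N * ε ^ 2 / 4 := by rw [ht]; field_simp
    have h2 : (3 * δ) ^ 2 ≤ ε ^ 2 := pow_le_pow_left₀ (by positivity) hε3 2
    have h3 := mul_le_mul_of_nonneg_left h2 hN'.le
    rw [h1]
    nlinarith [mul_pos hN' (pow_pos hδ0 2)]
  have htail_le : Real.exp (-(s * t / 4)) * √2 ^ s ≤ failR₂ K s M N δ := by
    refine le_trans ?_ hR2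
    rw [mul_comm]
    have h2 : √2 ≤ 5 := by rw [Real.sqrt_le_left (by norm_num)]; norm_num
    gcongr
  have hsqrt : 1 / (3 * δ) ≤ √((1 + ε) * N / s) := by
    refine Real.le_sqrt_of_sq_le ?_
    rw [div_pow, div_le_div_iff₀ (by positivity) hs']
    nlinarith [mul_pos hε0 (mul_pos hN' (pow_pos hδ0 2))]
  have hlower : 1 / (1 + ε) - ε * √((1 + ε) * N / s) ≤ 0 := by
    have h1 : 1 / (1 + ε) ≤ 1 := by rw [div_le_one (by linarith)]; linarith
    have h2 : 1 ≤ ε * √((1 + ε) * N / s) := by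
      calc (1 : ℝ) = 3 * δ * (1 / (3 * δ)) := by field_simp
        _ ≤ _ := mul_le_mul hε3 hsqrt (by positivity) hε0.le
    linarith
  have hupper : t ≤ 1 + ε * (1 + √((1 + ε) * N / s)) + N * ε ^ 2 / (4 * s) := by
    have : 0 ≤ ε * (1 + √((1 + ε) * N / s)) := by positivity
    rw [ht]
    linarith
  have hcover : μ.real Set.univ ≤
      μ.real ({ω | 1 / (1 + ε) - ε * √((1 + ε) * (N : ℝ) / (s : ℝ)) ≤
          (N : ℝ) / (s : ℝ) ^ 2 * gramSchmidtOverlap (A ω) (B ω) ∧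
        (N : ℝ) / (s : ℝ) ^ 2 * gramSchmidtOverlap (A ω) (B ω) ≤
          1 + ε * (1 + √((1 + ε) * (N : ℝ) / (s : ℝ))) + (N : ℝ) * ε ^ 2 / (4 * (s : ℝ))} ∪
      {ω | t ≤ N / (s : ℝ) ^ 2 * gramSchmidtOverlap (A ω) (B ω)}) := by
    refine measureReal_mono (fun ω _ => ?_) (measure_ne_top _ _)
    rcases le_or_gt t (N / (s : ℝ) ^ 2 * gramSchmidtOverlap (A ω) (B ω)) with h | h
    · exact Or.inr h
    · exact Or.inl ⟨hlower.trans
        (mul_nonneg (by positivity) (gramSchmidtOverlap_nonneg _ _)), h.le.trans hupper⟩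
  have hunion := hcover.trans (measureReal_union_le _ _)
  rw [probReal_univ] at hunion
  linarith
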